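/- Let $D=\{z\in\mathbb C:|z|<1\}$, $\overline D=\{z\in\mathbb C:|z|\le 1\}$ and $T=\{z\in\mathbb C:|z|=1\}$. Let $\overline{\mathbb C}=\mathbb C\cup\mathbb C^\infty$, where $\mathbb C^\infty=\{\infty e^{i\theta}:\theta\in\mathbb R\}$, with the metric $d(w_1,w_2)=|G(w_1)-G(w_2)|$, where $G(z)=\frac{z}{1+|z|}$ for $z\in\mathbb C$ and $G(\infty e^{i\theta})=e^{i\theta}$. Let $\overline A(D)$ be the set of all continuous functions $f:\overline D\to\overline{\mathbb C}$ of one of the following two types: (a) finite type: $f(D)\subset\mathbb C$ and $f|_D$ is holomorphic; (b) infinite type: $f(z)=\infty e^{i\theta(z)}$ for all $z\in\overline D$, where $\theta:\overline D\to\mathbb R$ is continuous on $\overline D$ and harmonic in $D$. Equip $\overline A(D)$ with the metric $\overline d(f,g)=\sup_{|z|\le 1}d(f(z),g(z))$. Let $\eta$ be a Hausdorff measure function, that is, a non-decreasing right-continuous function $\eta:[0,\infty)\to[0,\infty)$ with $\eta(0)=0$ and $\eta(t)>0$ for $t>0$, and let $$\Lambda_\eta(E)=\lim_{\delta\to0^+}\inf\Big\{\sum_{i}\eta(\operatorname{diam}A_i):E\subset\bigcup_i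 A_i,\ \operatorname{diam}A_i\le\delta\Big\}$$ (the infimum being over countable covers) be the corresponding Hausdorff measure. For $f\in\overline A(D)$ of finite type put $E_f=\{\zeta\in T: f(\zeta)\notin f(D)\}$. Then the set of all $f\in\overline A(D)$ of finite type such that $\Lambda_\eta(E_f)=0$ is a dense $G_\delta$ subset of $\overline A(D)$. -/

import Mathlib

open scoped NNReal ENNReal

noncomputable section

namespace ExtDisc

/-- The compactification `ℂ ∪ {∞ e^{iθ} : θ ∈ ℝ}` of the plane by a circle of points at infinity;
`inf u` is the point `∞ u`, for `u` unimodular. -/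
inductive CBar : Type
  | fin (z : ℂ) : CBar
  | inf (u : Circle) : CBar

namespace CBar

/-- The identification of the compactified plane with the closed unit disc:
`z ↦ z / (1 + |z|)` and `∞ e^{iθ} ↦ e^{iθ}`. -/
def toDisc : CBar → ℂ
  | fin z => z / (1 + ‖z‖ : ℝ)
  | inf u => u

theorem norm_toDisc_fin (z : ℂ) : ‖toDisc (fin z)‖ = ‖z‖ / (1 + ‖z‖) := by
  have h : (0 : ℝ) ≤ 1 + ‖z‖ := by positivity
  rw [toDisc, norm_div, Complex.norm_real, Real.norm_of_nonneg h]

theorem norm_toDisc_fin_lt_one (z : ℂ) : ‖toDisc (fin z)‖ < 1 := by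
  have h : (0 : ℝ) < 1 + ‖z‖ := by positivity
  rw [norm_toDisc_fin, div_lt_one h]
  linarith

theorem toDisc_injective : Function.Injective toDisc := by
  rintro (z | u) (w | v) h
  · have hz : (0 : ℝ) < 1 + ‖z‖ := by positivity
    have hw : (0 : ℝ) < 1 + ‖w‖ := by positivity
    have hn : ‖z‖ = ‖w‖ := by
      have := congrArg norm h
      rw [norm_toDisc_fin, norm_toDisc_fin, div_eq_div_iff hz.ne' hw.ne'] at this
      linarith
    have hc : ((1 + ‖w‖ : ℝ) : ℂ) ≠ 0 := by exact_mod_cast hw.ne'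
    simp only [toDisc, hn] at h
    rw [div_left_inj' hc] at h
    rw [h]
  · have := norm_toDisc_fin_lt_one z
    rw [h] at this
    exact absurd (Circle.norm_coe _) this.ne
  · have := norm_toDisc_fin_lt_one w
    rw [← h] at this
    exact absurd (Circle.norm_coe _) this.ne
  · simp only [toDisc] at h
    rw [Circle.coe_injective h]

/-- The metric `d(x, y) = |toDisc x - toDisc y|`, carried over from the closed unit disc. -/
instance : MetricSpace CBar :=
  MetricSpace.induced toDisc toDisc_injective inferInstance

theorem dist_def (x y : CBar) : dist x y = ‖toDisc x - toDisc y‖ :=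
  dist_eq_norm (toDisc x) (toDisc y)

end CBar

/-- The closed unit disc, as a compact metric space. -/
abbrev ClosedDisc : Type := Metric.closedBall (0 : ℂ) 1

/-- The open unit disc `D`, as a subset of the closed one. -/
def openDisc : Set ClosedDisc := {z | ‖(z : ℂ)‖ < 1}

/-- The unit circle `T`, as a subset of the closed disc. -/
def unitCircle : Set ClosedDisc := {z | ‖(z : ℂ)‖ = 1}

/-- Finite type: on the open disc, `f` takes finite values and is holomorphic. -/
def IsFiniteType (f : C(ClosedDisc, CBar)) : Prop :=
  ∃ g : ℂ → ℂ, DifferentiableOn ℂ g (Metric.ball 0 1) ∧ ∀ z ∈ openDisc, f z = CBar.fin (g z)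

/-- Infinite type: `f(z) = ∞ e^{iθ(z)}` on the closed disc, with `θ` real-valued, continuous on
the closed disc and harmonic in the open disc. -/
def IsInfiniteType (f : C(ClosedDisc, CBar)) : Prop :=
  ∃ θ : ℂ → ℝ, ContinuousOn θ (Metric.closedBall 0 1) ∧
    InnerProductSpace.HarmonicOnNhd θ (Metric.ball 0 1) ∧
    ∀ z : ClosedDisc, f z = CBar.inf (Circle.exp (θ z))

/-- The extended disc algebra. As a subspace of `C(ClosedDisc, CBar)` it carries the metric
`sup_{|z| ≤ 1} d(f z, g z)`, see `ABar.dist_eq_iSup`. -/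
abbrev ABar : Type := {f : C(ClosedDisc, CBar) // IsFiniteType f ∨ IsInfiniteType f}

theorem ABar.dist_eq_iSup (f g : ABar) : dist f g = ⨆ z : ClosedDisc, dist (f.1 z) (g.1 z) :=
  ContinuousMap.dist_eq_iSup

/-- The set of `ζ ∈ T` with `f(ζ) ∉ f(D)`, as a subset of the plane. -/
def exceptionalSet (f : C(ClosedDisc, CBar)) : Set ℂ :=
  (↑) '' {ζ : ClosedDisc | ζ ∈ unitCircle ∧ f ζ ∉ f '' openDisc}

/-- Hausdorff measure functions `η : [0, ∞) → [0, ∞)`: non-decreasing, right-continuous, zero at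
`0` and positive elsewhere. In particular `η(t) → 0` as `t → 0`. -/
structure IsHausdorffMeasureFunction (η : ℝ≥0 → ℝ≥0) : Prop where
  monotone : Monotone η
  rightContinuous : ∀ t, ContinuousWithinAt η (Set.Ici t) t
  zero : η 0 = 0
  pos : ∀ t, 0 < t → 0 < η t

/-- The Hausdorff measure `Λ_η` on the plane: the limit as `δ → 0` of the infimum of
`∑ η(diam Aᵢ)` over countable covers by sets of diameter at most `δ`. (The value of the gauge at
infinite diameter plays no role.) -/
def hausdorffMeasureOf (η : ℝ≥0 → ℝ≥0) : MeasureTheory.Measure ℂ :=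
  MeasureTheory.Measure.mkMetric fun t : ℝ≥0∞ => (η t.toNNReal : ℝ≥0∞)

end ExtDisc

end

/-! ### Hausdorff contents and thin open covers -/

namespace ExtDisc

open MeasureTheory Metric Set Filter Topology

/-! For nonconstant `f` of finite type, the relation `f(ζ) ∈ f(D)` survives small changes of both
`f` and `ζ`, by a quantitative open mapping theorem (`isOpen_overlapSet`). By compactness of `T \
U`, having `E_f` inside some open `U` of content at most `1/n` at scale `1/n` is then an open
condition on `f`. Right continuity of the gauge lets null sets be covered by such `U`, so nullity of
`E_f` is the conjunction of these conditions over `n`. Finite constants have `E_f` empty but are not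
stable; they form a separate G_δ.

For density, Baire's theorem is applied in the disc algebra, which is complete and has dense image
in `ABar`. The core is `exists_perturbation`: near each point `j` of a fine net on `T`, a small
concentrated bump makes the function cover a disc of values much larger than its oscillation near
`j`, and hardly changes it elsewhere. Only boundary points very close to the net can remain
exceptional. The net is fixed before the radius of the excluded discs, so their total content can be
made arbitrarily small for any gauge. -/

/-- The outer measure obtained from covers by sets of diameter at most `r`; as `r → 0` it
increases to `hausdorffMeasureOf η`. -/
noncomputable def hausdorffContent (η : ℝ≥0 → ℝ≥0) (r : ℝ≥0∞) : OuterMeasure ℂ :=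
  OuterMeasure.mkMetric'.pre (fun s => (η (ediam s).toNNReal : ℝ≥0∞)) r

theorem hausdorffContent_le_gauge (η : ℝ≥0 → ℝ≥0) {r : ℝ≥0∞} {s : Set ℂ} (hs : ediam s ≤ r) :
    hausdorffContent η r s ≤ (η (ediam s).toNNReal : ℝ≥0∞) :=
  OuterMeasure.mkMetric'.pre_le hs

theorem tendsto_hausdorffContent (η : ℝ≥0 → ℝ≥0) (s : Set ℂ) :
    Tendsto (fun n : ℕ => hausdorffContent η (n : ℝ≥0∞)⁻¹ s) atTop
      (𝓝 (hausdorffMeasureOf η s)) := by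
  rw [hausdorffMeasureOf, ← OuterMeasure.coe_mkMetric]
  exact OuterMeasure.mkMetric'.tendsto_pre_nat _ s

theorem hausdorffMeasureOf_eq_zero_of_content (η : ℝ≥0 → ℝ≥0) {E : Set ℂ}
    (h : ∀ n : ℕ, ∃ U, E ⊆ U ∧ hausdorffContent η (n : ℝ≥0∞)⁻¹ U ≤ (n : ℝ≥0∞)⁻¹) :
    hausdorffMeasureOf η E = 0 := by
  refine tendsto_nhds_unique (tendsto_hausdorffContent η E)
    (tendsto_of_tendsto_of_tendsto_of_le_of_le tendsto_const_nhds
      ENNReal.tendsto_inv_nat_nhds_zero (fun _ => zero_le) fun n => ?_)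
  obtain ⟨U, hEU, hU⟩ := h n
  exact (measure_mono hEU).trans hU

/-- Right continuity of the gauge allows one to thicken a set at small cost. -/
theorem IsHausdorffMeasureFunction.exists_thickening {η : ℝ≥0 → ℝ≥0}
    (hη : IsHausdorffMeasureFunction η) {r ε : ℝ≥0∞} (hε : ε ≠ 0) {A : Set ℂ}
    (hA : ediam A < r) :
    ∃ δ : ℝ, 0 < δ ∧
      hausdorffContent η r (thickening δ A) ≤ (η (ediam A).toNNReal : ℝ≥0∞) + ε := by
  set d := (ediam A).toNNReal with hd
  have hdA : ediam A = d := (ENNReal.coe_toNNReal (ne_top_of_lt hA)).symm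
  -- A `δ`-thickening has diameter at most `d + 2δ`, which approaches `d` from the right, the side
  -- on which the gauge is continuous.
  have hcont : Tendsto (fun δ : ℝ≥0 => (η (d + 2 * δ) : ℝ≥0∞)) (𝓝 0) (𝓝 (η d)) := by
    refine ENNReal.tendsto_coe.2 ((hη.rightContinuous d).tendsto.comp ?_)
    refine tendsto_nhdsWithin_iff.2 ⟨?_, Eventually.of_forall fun δ => by simp⟩
    have : Continuous fun δ : ℝ≥0 => d + 2 * δ := by fun_prop
    simpa using this.tendsto 0
  have hdiam : Tendsto (fun δ : ℝ≥0 => ((d + 2 * δ : ℝ≥0) : ℝ≥0∞)) (𝓝 0) (𝓝 d) := by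
    refine ENNReal.tendsto_coe.2 ?_
    have : Continuous fun δ : ℝ≥0 => d + 2 * δ := by fun_prop
    simpa using this.tendsto 0
  have h1 : ∀ᶠ δ : ℝ≥0 in 𝓝 0, (η (d + 2 * δ) : ℝ≥0∞) < η d + ε :=
    hcont.eventually_lt_const (ENNReal.lt_add_right ENNReal.coe_ne_top hε)
  have h2 : ∀ᶠ δ : ℝ≥0 in 𝓝 0, ((d + 2 * δ : ℝ≥0) : ℝ≥0∞) < r :=
    hdiam.eventually_lt_const (hdA ▸ hA)
  obtain ⟨δ, ⟨hδ1, hδ2⟩, hδ0⟩ :=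
    (((h1.and h2).filter_mono nhdsWithin_le_nhds).and
      (self_mem_nhdsWithin (s := Ioi (0 : ℝ≥0)))).exists
  have hle : ediam (thickening (δ : ℝ) A) ≤ ((d + 2 * δ : ℝ≥0) : ℝ≥0∞) := by
    refine (ediam_thickening_le δ).trans ?_
    rw [hdA]; push_cast; exact le_rfl
  refine ⟨δ, by exact_mod_cast hδ0, (hausdorffContent_le_gauge η (hle.trans hδ2.le)).trans ?_⟩
  refine le_trans ?_ hδ1.le
  exact_mod_cast hη.monotone (ENNReal.toNNReal_mono ENNReal.coe_ne_top hle)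

/-- Cover at a scale `q < r` with total gauge below `q`; the gap `r - q` pays for thickening the
covering sets, with summable costs, and `q < r` leaves room for their diameters to grow. -/
theorem IsHausdorffMeasureFunction.exists_isOpen_content_le {η : ℝ≥0 → ℝ≥0}
    (hη : IsHausdorffMeasureFunction η) {E : Set ℂ} (hE : hausdorffMeasureOf η E = 0)
    {r : ℝ≥0∞} (hr : 0 < r) :
    ∃ U, IsOpen U ∧ E ⊆ U ∧ hausdorffContent η r U ≤ r := by
  obtain ⟨q, hq0, hqr⟩ := exists_between hr
  obtain ⟨a, ha0, hsum⟩ := ENNReal.exists_pos_sum_of_countable' (tsub_pos_of_lt hqr).ne' ℕ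
  rw [hausdorffMeasureOf, Measure.mkMetric_apply] at hE
  have h0 := nonpos_iff_eq_zero.1 ((le_iSup₂ (f := fun (r : ℝ≥0∞) (_ : 0 < r) =>
    ⨅ (t : ℕ → Set ℂ) (_ : E ⊆ iUnion t) (_ : ∀ n, ediam (t n) ≤ r),
      ∑' n, ⨆ _ : (t n).Nonempty, (η (ediam (t n)).toNNReal : ℝ≥0∞)) q hq0).trans hE.le)
  have hlt := h0.trans_lt hq0
  simp only [iInf_lt_iff] at hlt
  obtain ⟨t, htE, htd, hts⟩ := hlt
  choose δ hδ0 hδ using fun n => hη.exists_thickening (ha0 n).ne' ((htd n).trans_lt hqr)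
  refine ⟨⋃ n, thickening (δ n) (t n), isOpen_iUnion fun n => isOpen_thickening,
    htE.trans (iUnion_mono fun n => self_subset_thickening (hδ0 n) _), ?_⟩
  calc hausdorffContent η r (⋃ n, thickening (δ n) (t n))
      ≤ ∑' n, hausdorffContent η r (thickening (δ n) (t n)) := measure_iUnion_le _
    _ ≤ ∑' n, ((⨆ _ : (t n).Nonempty, (η (ediam (t n)).toNNReal : ℝ≥0∞)) + a n) := by
        refine ENNReal.tsum_le_tsum fun n => ?_
        rcases (t n).eq_empty_or_nonempty with h | h
        · simp [h]
        · simpa [h] using hδ n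
    _ = (∑' n, ⨆ _ : (t n).Nonempty, (η (ediam (t n)).toNNReal : ℝ≥0∞)) + ∑' n, a n :=
        ENNReal.tsum_add
    _ ≤ q + (r - q) := add_le_add hts.le hsum.le
    _ = r := add_tsub_cancel_of_le hqr.le

/-- Points have gauge `η 0 = 0`, so each can be thickened at cost `r / F.card`. -/
theorem IsHausdorffMeasureFunction.exists_balls_content_le {η : ℝ≥0 → ℝ≥0}
    (hη : IsHausdorffMeasureFunction η) (F : Finset ℂ) {r : ℝ≥0∞} (hr : 0 < r) :
    ∃ δ : ℝ, 0 < δ ∧ hausdorffContent η r (⋃ j ∈ F, ball j δ) ≤ r := by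
  rcases F.eq_empty_or_nonempty with rfl | hF
  · exact ⟨1, one_pos, by simp⟩
  have hc : (F.card : ℝ≥0∞) ≠ 0 := by simpa using hF.ne_empty
  have hε : r / F.card ≠ 0 := (ENNReal.div_pos hr.ne' (by simp)).ne'
  choose! δ hδ0 hδ using fun j : ℂ =>
    hη.exists_thickening (r := r) hε (A := {j}) (by simpa using hr)
  obtain ⟨i, hi, hmin⟩ := F.exists_min_image δ hF
  refine ⟨δ i, hδ0 i, (measure_biUnion_finset_le F _).trans ?_⟩
  calc ∑ j ∈ F, hausdorffContent η r (ball j (δ i)) ≤ ∑ j ∈ F, r / F.card := by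
        refine Finset.sum_le_sum fun j hj => ?_
        refine (measure_mono (ball_subset_ball (hmin j hj))).trans ?_
        simpa [thickening_singleton, hη.zero] using hδ j
    _ = r := by
        rw [Finset.sum_const, nsmul_eq_mul]
        exact ENNReal.mul_div_cancel hc (by simp)

end ExtDisc

/-! ### Density of the disc algebra in the extended disc algebra -/

namespace ExtDisc

open Metric Set Filter Topology

namespace CBar

theorem continuous_toDisc : Continuous toDisc :=
  continuous_induced_dom

theorem continuous_fin : Continuous fin := by
  refine continuous_induced_rng.2 ?_
  change Continuous fun z : ℂ => z / ((1 + ‖z‖ : ℝ) : ℂ)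
  refine continuous_id.div (by fun_prop) fun z => ?_
  exact_mod_cast (by positivity : (0 : ℝ) < 1 + ‖z‖).ne'

/-- The finite value of a point of the compactified plane, as a function of its position in the
closed disc; it vanishes at infinite points. -/
noncomputable def val (x : CBar) : ℂ := toDisc x / ((1 - ‖toDisc x‖ : ℝ) : ℂ)

@[simp]
theorem val_fin (z : ℂ) : val (fin z) = z := by
  have h : (1 + ‖z‖ : ℝ) ≠ 0 := by positivity
  have h' : ((1 + ‖z‖ : ℝ) : ℂ) ≠ 0 := by exact_mod_cast h
  have : 1 - ‖toDisc (fin z)‖ = (1 + ‖z‖)⁻¹ := by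
    rw [norm_toDisc_fin]; field_simp; ring
  rw [val, this, toDisc, Complex.ofReal_inv, div_inv_eq_mul, div_mul_cancel₀ _ h']

theorem norm_toDisc_lt_one_iff {x : CBar} : ‖toDisc x‖ < 1 ↔ x ∈ range fin := by
  cases x with
  | fin z => simpa using norm_toDisc_fin_lt_one z
  | inf u => simpa [toDisc] using (Circle.norm_coe u).ge

theorem isOpen_range_fin : IsOpen (range fin) := by
  have : range fin = {x | ‖toDisc x‖ < 1} := by ext x; exact norm_toDisc_lt_one_iff.symm
  rw [this]
  exact isOpen_lt continuous_toDisc.norm continuous_const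

theorem continuousAt_val (z : ℂ) : ContinuousAt val (fin z) := by
  refine continuous_toDisc.continuousAt.div (by have := continuous_toDisc; fun_prop) ?_
  exact_mod_cast (sub_pos.2 (norm_toDisc_fin_lt_one z)).ne'

/-- Finite points of large modulus are close to the infinite point in the same direction. -/
theorem dist_fin_inf_le {R : ℝ} (hR : 0 < R) (u : Circle) :
    dist (fin (R * u)) (inf u) ≤ R⁻¹ := by
  have h : (0 : ℝ) < 1 + R := by positivity
  have hn : ‖(R * u : ℂ)‖ = R := by
    rw [norm_mul, Circle.norm_coe, Complex.norm_real, Real.norm_of_nonneg hR.le, mul_one]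
  have hc : ((1 + R : ℝ) : ℂ) ≠ 0 := by exact_mod_cast h.ne'
  have : toDisc (fin (R * u)) - toDisc (inf u) = -(((1 + R : ℝ) : ℂ)⁻¹ * u) := by
    rw [toDisc, toDisc, hn]; field_simp; push_cast; ring
  rw [dist_def, this, norm_neg, norm_mul, norm_inv, Complex.norm_real, Circle.norm_coe, mul_one,
    Real.norm_of_nonneg h.le]
  gcongr
  linarith

end CBar

/-- The centre of the closed disc. -/
def center : ClosedDisc := ⟨0, by simp⟩

theorem center_mem_openDisc : center ∈ openDisc := by simp [center, openDisc]

/-- Functions of infinite type have no finite value, so the value at one interior point decides the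
type; this makes finite type an open condition. -/
theorem isFiniteType_iff (f : ABar) : IsFiniteType f.1 ↔ f.1 center ∈ range CBar.fin := by
  refine ⟨fun ⟨g, _, hg⟩ => ⟨_, (hg _ center_mem_openDisc).symm⟩, fun ⟨w, hw⟩ => ?_⟩
  refine f.2.resolve_right ?_
  rintro ⟨θ, -, -, h⟩
  have := h center
  rw [← hw] at this
  cases this

theorem isOpen_isFiniteType : IsOpen {f : ABar | IsFiniteType f.1} := by
  simp only [isFiniteType_iff]
  exact CBar.isOpen_range_fin.preimage
    ((continuous_eval_const center).comp continuous_subtype_val)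

/-- Multiplication by `r ∈ [0, 1]` on the closed disc. -/
noncomputable def scale (r : unitInterval) (z : ClosedDisc) : ClosedDisc :=
  ⟨(r : ℝ) * z, by
    have hz : ‖(z : ℂ)‖ ≤ 1 := mem_closedBall_zero_iff.1 z.2
    have := mul_le_one₀ r.2.2 (norm_nonneg (z : ℂ)) hz
    simpa [abs_of_nonneg r.2.1] using this⟩

theorem continuous_scale : Continuous fun p : unitInterval × ClosedDisc => scale p.1 p.2 := by
  unfold scale
  fun_prop

theorem exists_scale_close {Y : Type*} [MetricSpace Y] (f : C(ClosedDisc, Y)) {ε : ℝ}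
    (hε : 0 < ε) :
    ∃ r : unitInterval, r < 1 ∧ ∀ z, dist (f (scale r z)) (f z) < ε := by
  have h : ∀ᶠ r : unitInterval in 𝓝 1, ∀ z ∈ (univ : Set ClosedDisc),
      dist (f (scale r z)) (f z) < ε := by
    refine isCompact_univ.eventually_forall_of_forall_eventually fun z _ => ?_
    have hc : Continuous fun p : unitInterval × ClosedDisc =>
        dist (f (scale p.1 p.2)) (f p.2) := by
      have := continuous_scale
      fun_prop
    refine hc.continuousAt.eventually_lt_const ?_
    simpa [scale] using hε
  have h' := (h.filter_mono (nhdsWithin_le_nhds (s := Iio (1 : unitInterval)))).and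
    self_mem_nhdsWithin
  have : (𝓝[<] (1 : unitInterval)).NeBot := nhdsLT_neBot_of_exists_lt ⟨0, zero_lt_one⟩
  obtain ⟨r, hr, hr1⟩ := h'.exists
  exact ⟨r, hr1, fun z => hr z (mem_univ _)⟩

/-- The disc algebra: continuous functions on the closed disc, holomorphic inside. -/
abbrev DiscAlgebra : Type :=
  {f : C(ClosedDisc, ℂ) // ∃ g : ℂ → ℂ, DifferentiableOn ℂ g (ball 0 1) ∧
    ∀ z ∈ openDisc, f z = g z}

/-- Uniform limits of holomorphic functions are holomorphic. This gives the completeness needed for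
Baire's theorem. -/
theorem isClosed_discAlgebra : IsClosed {f : C(ClosedDisc, ℂ) |
    ∃ g : ℂ → ℂ, DifferentiableOn ℂ g (ball 0 1) ∧ ∀ z ∈ openDisc, f z = g z} := by
  classical
  refine isClosed_of_closure_subset fun f hf => ?_
  obtain ⟨u, hu, hlim⟩ := mem_closure_iff_seq_limit.1 hf
  choose g hg hug using hu
  let F : ℂ → ℂ := fun z => if h : z ∈ closedBall (0 : ℂ) 1 then f ⟨z, h⟩ else 0
  have hF : ∀ z : ClosedDisc, F z = f z := fun z => dif_pos z.2
  refine ⟨F, ?_, fun z _ => (hF z).symm⟩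
  have hunif : TendstoUniformlyOn g F atTop (ball 0 1) := by
    rw [Metric.tendstoUniformlyOn_iff]
    intro ε hε
    filter_upwards [(Metric.tendsto_nhds.1 hlim) ε hε] with n hn z hz
    let z' : ClosedDisc := ⟨z, ball_subset_closedBall hz⟩
    have h1 : F z = f z' := hF z'
    have h2 : g n z = u n z' := (hug n z' (by simpa [openDisc] using hz)).symm
    rw [h1, h2, dist_comm]
    exact (ContinuousMap.dist_apply_le_dist _).trans_lt hn
  exact hunif.tendstoLocallyUniformlyOn.differentiableOn (Eventually.of_forall hg) isOpen_ball

instance : CompleteSpace DiscAlgebra :=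
  isClosed_discAlgebra.completeSpace_coe

/-- The inclusion of the disc algebra in the extended disc algebra. -/
noncomputable def DiscAlgebra.toABar (f : DiscAlgebra) : ABar :=
  ⟨⟨fun z => CBar.fin (f.1 z), CBar.continuous_fin.comp f.1.continuous⟩, Or.inl <| by
    obtain ⟨g, hg, h⟩ := f.2
    exact ⟨g, hg, fun z hz => congrArg CBar.fin (h z hz)⟩⟩

theorem DiscAlgebra.continuous_toABar : Continuous DiscAlgebra.toABar :=
  Continuous.subtype_mk ((ContinuousMap.continuous_postcomp
    (⟨CBar.fin, CBar.continuous_fin⟩ : C(ℂ, CBar))).comp continuous_subtype_val) _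

/-- Scaling a holomorphic function on the disc gives an element of the disc algebra. -/
noncomputable def DiscAlgebra.ofScale (g : ℂ → ℂ) (hg : DifferentiableOn ℂ g (ball 0 1))
    (r : unitInterval) (hr : r < 1) : DiscAlgebra :=
  have hmaps : ∀ z ∈ closedBall (0 : ℂ) 1, (r : ℝ) * z ∈ ball (0 : ℂ) 1 := fun z hz => by
    have hz : ‖z‖ ≤ 1 := by simpa using hz
    have h1 : (r : ℝ) < 1 := hr
    have := mul_le_of_le_one_right r.2.1 hz
    simpa [abs_of_nonneg r.2.1] using this.trans_lt h1
  ⟨⟨fun z => g ((r : ℝ) * z), by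
      have := hg.continuousOn.comp_continuous (f := fun z : ClosedDisc => ((r : ℝ) : ℂ) * z)
        (by fun_prop) fun z => hmaps z z.2
      exact this⟩,
    fun z => g ((r : ℝ) * z), hg.comp (by fun_prop) fun z hz =>
      hmaps z (ball_subset_closedBall hz), fun _ _ => rfl⟩

theorem scale_mem_openDisc {r : unitInterval} (hr : r < 1) (z : ClosedDisc) :
    scale r z ∈ openDisc := by
  have hz : ‖(z : ℂ)‖ ≤ 1 := mem_closedBall_zero_iff.1 z.2
  have h1 : (r : ℝ) < 1 := hr
  have := mul_le_of_le_one_right r.2.1 hz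
  simpa [openDisc, scale, abs_of_nonneg r.2.1] using this.trans_lt h1

theorem IsFiniteType.exists_discAlgebra_close {f : C(ClosedDisc, CBar)} (hf : IsFiniteType f)
    {ε : ℝ} (hε : 0 < ε) : ∃ p : DiscAlgebra, dist p.toABar.1 f < ε := by
  obtain ⟨g, hg, hfg⟩ := hf
  obtain ⟨r, hr1, hr⟩ := exists_scale_close f hε
  refine ⟨.ofScale g hg r hr1, (ContinuousMap.dist_lt_iff hε).2 fun z => ?_⟩
  convert hr z using 2
  exact (hfg _ (scale_mem_openDisc hr1 z)).symm

/-- Write `θ = Re H` with `H` holomorphic. Then `n exp(iH(rz))` has direction `e^{iθ(rz)}` and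
modulus `n e^{-Im H(rz)}`, which is uniformly large for large `n`. -/
theorem IsInfiniteType.exists_discAlgebra_close {f : C(ClosedDisc, CBar)}
    (hf : IsInfiniteType f) {ε : ℝ} (hε : 0 < ε) :
    ∃ p : DiscAlgebra, dist p.toABar.1 f < ε := by
  obtain ⟨θ, -, hharm, hfθ⟩ := hf
  obtain ⟨H, hH, hHθ⟩ := hharm.exists_analyticOnNhd_ball_re_eq
  obtain ⟨r, hr1, hr⟩ := exists_scale_close f (half_pos hε)
  let q := DiscAlgebra.ofScale H hH.differentiableOn r hr1
  obtain ⟨B, hB⟩ : ∃ B, ∀ z, ‖q.1 z‖ ≤ B := ⟨‖q.1‖, q.1.norm_coe_le_norm⟩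
  obtain ⟨n, hn⟩ := exists_nat_gt (Real.exp B / (ε / 2))
  have hn0 : (0 : ℝ) < n := lt_trans (by positivity) hn
  let p : DiscAlgebra := ⟨⟨fun z => n * Complex.exp (Complex.I * q.1 z), by fun_prop⟩, by
    obtain ⟨g, hg, hqg⟩ := q.2
    exact ⟨fun z => n * Complex.exp (Complex.I * g z), by fun_prop,
      fun z hz => by simp [hqg z hz]⟩⟩
  refine ⟨p, (ContinuousMap.dist_lt_iff hε).2 fun z => ?_⟩
  have hre : (q.1 z).re = θ (scale r z) :=
    hHθ (mem_ball_zero_iff.2 (scale_mem_openDisc hr1 z))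
  have hfs : f (scale r z) = CBar.inf (Circle.exp (q.1 z).re) := by rw [hfθ, hre]
  have hpz : p.toABar.1 z = CBar.fin
      ((n * Real.exp (-(q.1 z).im) : ℝ) * (Circle.exp (q.1 z).re : ℂ)) := by
    change CBar.fin (n * Complex.exp (Complex.I * q.1 z)) = _
    congr 1
    rw [Circle.coe_exp, Complex.ofReal_mul, Complex.ofReal_exp, mul_assoc, ← Complex.exp_add]
    congr 2
    · conv_lhs => rw [← Complex.re_add_im (q.1 z)]
      rw [mul_add, mul_comm _ (Complex.I), ← mul_assoc, Complex.I_mul_I]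
      push_cast
      ring
  have hR : (0 : ℝ) < n * Real.exp (-(q.1 z).im) := by positivity
  calc dist (p.toABar.1 z) (f z)
      ≤ dist (p.toABar.1 z) (f (scale r z)) + dist (f (scale r z)) (f z) := dist_triangle _ _ _
    _ < ε / 2 + ε / 2 := by
        refine add_lt_add_of_le_of_lt ?_ (hr z)
        rw [hpz, hfs]
        refine (CBar.dist_fin_inf_le hR _).trans ?_
        rw [mul_inv, ← Real.exp_neg, neg_neg, inv_mul_le_iff₀ hn0]
        have h1 : Real.exp (q.1 z).im ≤ Real.exp B :=
          Real.exp_le_exp.2 ((le_abs_self _).trans ((Complex.abs_im_le_norm _).trans (hB z)))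
        have h2 := (div_lt_iff₀ (half_pos hε)).1 hn
        linarith
    _ = ε := add_halves ε

theorem DiscAlgebra.denseRange_toABar : DenseRange DiscAlgebra.toABar := by
  refine Metric.denseRange_iff.2 fun f ε hε => ?_
  obtain ⟨p, hp⟩ : ∃ p : DiscAlgebra, dist p.toABar.1 f.1 < ε :=
    f.2.elim (·.exists_discAlgebra_close hε) (·.exists_discAlgebra_close hε)
  exact ⟨p, by rw [dist_comm]; exact hp⟩

end ExtDisc

/-! ### Quantitative open mapping and boundary bumps -/

namespace ExtDisc

open Metric Set Filter Topology

/-- A quantitative open mapping statement: if `f` stays at distance `ε` from `f z₀` on a circle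
around `z₀`, it takes inside the circle every value within `ε / 2` of `f z₀`. -/
theorem ball_subset_image_of_sphere {f : ℂ → ℂ} {z₀ : ℂ} {r ε : ℝ}
    (h : DiffContOnCl ℂ f (ball z₀ r)) (hr : 0 < r) (hε : 0 < ε)
    (hf : ∀ z ∈ sphere z₀ r, ε ≤ ‖f z - f z₀‖) :
    ball (f z₀) (ε / 2) ⊆ f '' closedBall z₀ r := by
  refine h.ball_subset_image_closedBall hr hf fun hev => ?_
  simp only [not_not] at hev
  -- If `f` were constant near `z₀`, it would be constant up to the circle, against the lower bound
  -- there.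
  have heq : EqOn f (fun _ => f z₀) (ball z₀ r) :=
    (h.differentiableOn.analyticOnNhd isOpen_ball).eqOn_of_preconnected_of_eventuallyEq
      analyticOnNhd_const (convex_ball z₀ r).isPreconnected (mem_ball_self hr) hev
  have heq' : EqOn f (fun _ => f z₀) (closedBall z₀ r) :=
    heq.of_subset_closure (closure_ball z₀ hr.ne' ▸ h.continuousOn) continuousOn_const
      ball_subset_closedBall (closure_ball z₀ hr.ne').ge
  obtain ⟨z, hz⟩ := (NormedSpace.sphere_nonempty (x := z₀) (r := r)).2 hr.le
  have := hf z hz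
  rw [heq' (sphere_subset_closedBall hz)] at this
  simp at this
  linarith

/-- An entire function that decays to the left in the left half-plane and has a zero there. -/
noncomputable def bump (L : ℂ) : ℂ := Complex.exp L * (1 - 2 * Complex.exp L)

theorem differentiable_bump : Differentiable ℂ bump := by unfold bump; fun_prop

theorem norm_bump_le {L : ℂ} (hL : L.re ≤ 0) : ‖bump L‖ ≤ 3 * Real.exp L.re := by
  have h1 : ‖Complex.exp L‖ ≤ 1 := by rw [Complex.norm_exp]; exact Real.exp_le_one_iff.2 hL
  have h2 : ‖1 - 2 * Complex.exp L‖ ≤ 3 := by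
    refine (norm_sub_le _ _).trans ?_
    rw [norm_mul, norm_one, Complex.norm_ofNat]
    linarith
  rw [bump, norm_mul, mul_comm, ← Complex.norm_exp]
  gcongr

/-- A zero of `bump`. -/
noncomputable def bumpZero : ℂ := ((-Real.log 2 : ℝ) : ℂ)

theorem exp_bumpZero : Complex.exp bumpZero = 1 / 2 := by
  rw [bumpZero, ← Complex.ofReal_exp, Real.exp_neg, Real.exp_log two_pos]
  norm_num

theorem bump_bumpZero : bump bumpZero = 0 := by
  rw [bump, exp_bumpZero]; norm_num

/-- The zeros of `bump` are the translates of `bumpZero` by `2πiℤ`, too far apart for another to lie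
on this circle. -/
theorem bump_ne_zero {L : ℂ} (hL : L ∈ sphere bumpZero (1 / 2)) : bump L ≠ 0 := by
  intro h0
  have h1 : Complex.exp L = 1 / 2 := by
    rcases mul_eq_zero.1 h0 with h | h
    · exact absurd h (Complex.exp_ne_zero _)
    · linear_combination (-1 / 2 : ℂ) * h
  obtain ⟨n, hn⟩ := Complex.exp_eq_exp_iff_exists_int.1 (h1.trans exp_bumpZero.symm)
  have hd : ‖(n : ℂ) * (2 * Real.pi * Complex.I)‖ = 1 / 2 := by
    rw [← mem_sphere_iff_norm.1 hL, hn, add_sub_cancel_left]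
  have hd' : |(n : ℝ)| * (2 * Real.pi) = 1 / 2 := by
    simpa [abs_of_pos Real.pi_pos] using hd
  rcases eq_or_ne n 0 with rfl | hn0
  · norm_num at hd'
  · have : (1 : ℝ) ≤ |(n : ℝ)| := by exact_mod_cast Int.one_le_abs hn0
    nlinarith [Real.pi_gt_three]

theorem exists_le_norm_bump : ∃ c > 0, ∀ L ∈ sphere bumpZero (1 / 2), c ≤ ‖bump L‖ := by
  obtain ⟨L, hL, hmin⟩ := (isCompact_sphere bumpZero (1 / 2)).exists_isMinOn
    (NormedSpace.sphere_nonempty.2 (by norm_num)) differentiable_bump.continuous.norm.continuousOn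
  exact ⟨_, norm_pos_iff.2 (bump_ne_zero hL), fun L' hL' => hmin hL'⟩

theorem norm_le_two_of_mem {L : ℂ} (hL : L ∈ closedBall bumpZero (1 / 2)) : ‖L‖ ≤ 2 := by
  have h1 := mem_closedBall_iff_norm.1 hL
  have h2 : ‖bumpZero‖ ≤ 1 := by
    rw [bumpZero, Complex.norm_real, norm_neg, Real.norm_of_nonneg (Real.log_nonneg one_le_two)]
    linarith [Real.log_two_lt_d9]
  calc ‖L‖ = ‖(L - bumpZero) + bumpZero‖ := by rw [sub_add_cancel]
    _ ≤ 1 / 2 + 1 := (norm_add_le _ _).trans (add_le_add h1 h2)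
    _ ≤ 2 := by norm_num

theorem re_le_of_mem {L : ℂ} (hL : L ∈ closedBall bumpZero (1 / 2)) : L.re ≤ -(1 / 8) := by
  have h1 := (Complex.abs_re_le_norm _).trans (mem_closedBall_iff_norm.1 hL)
  have h2 : (L - bumpZero).re = L.re + Real.log 2 := by
    rw [bumpZero, Complex.sub_re, Complex.ofReal_re, sub_neg_eq_add]
  rw [h2] at h1
  linarith [(abs_le.1 h1).2, Real.log_two_gt_d9]

/-- The point of the disc near `j ∈ T` at which the bump concentrated near `j` takes the value
`bump L`. -/
theorem norm_mul_one_add_div_lt_one {j L : ℂ} {M : ℝ} (hj : ‖j‖ = 1) (hM : 20 ≤ M)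
    (hL : L ∈ closedBall bumpZero (1 / 2)) : ‖j * (1 + L / M)‖ < 1 := by
  rw [norm_mul, hj, one_mul]
  have hM0 : (0 : ℝ) < M := by linarith
  have h1 := norm_le_two_of_mem hL
  have h2 := re_le_of_mem hL
  have h3 : ‖1 + L / M‖ ^ 2 = 1 + 2 * L.re / M + ‖L‖ ^ 2 / M ^ 2 := by
    rw [Complex.sq_norm, Complex.sq_norm, Complex.normSq_apply, Complex.normSq_apply]
    simp only [Complex.add_re, Complex.one_re, Complex.div_ofReal_re, Complex.add_im,
      Complex.one_im, Complex.div_ofReal_im]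
    field_simp
    ring
  have h4 : 2 * L.re / M + ‖L‖ ^ 2 / M ^ 2 < 0 := by
    have : 2 * L.re / M + ‖L‖ ^ 2 / M ^ 2 = (2 * L.re * M + ‖L‖ ^ 2) / M ^ 2 := by field_simp
    rw [this]
    refine div_neg_of_neg_of_pos ?_ (by positivity)
    -- With `Re L ≤ -1/8`, `|L| ≤ 2` and `M ≥ 20`, the numerator is at most `-5 + 4`.
    nlinarith [norm_nonneg L]
  refine (sq_lt_one_iff₀ (norm_nonneg _)).1 ?_
  linarith

/-- The bump of parameter `M` concentrated near `j ∈ T`. -/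
noncomputable def bumpAt (M : ℝ) (j z : ℂ) : ℂ := bump (M * (z * starRingEnd ℂ j - 1))

theorem differentiable_bumpAt (M : ℝ) (j : ℂ) : Differentiable ℂ (bumpAt M j) := by
  unfold bumpAt
  exact differentiable_bump.comp (by fun_prop)

theorem bumpAt_mul_one_add_div {j L : ℂ} {M : ℝ} (hj : ‖j‖ = 1) (hM : M ≠ 0) :
    bumpAt M j (j * (1 + L / M)) = bump L := by
  have hc : (M : ℂ) ≠ 0 := by exact_mod_cast hM
  have hjj : j * starRingEnd ℂ j = 1 := by rw [Complex.mul_conj']; simp [hj]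
  have : (M : ℂ) * (j * (1 + L / M) * starRingEnd ℂ j - 1) = L := by
    rw [mul_right_comm, hjj]; field_simp; ring
  rw [bumpAt, this]

/-- For `|j| = 1` and `|z| ≤ 1`, expanding `|z - j|²` gives `Re (z j̄ - 1) ≤ -|z - j|² / 2`: the
bump has Gaussian decay away from `j`. -/
theorem norm_bumpAt_le {M : ℝ} (hM : 0 ≤ M) {j z : ℂ} (hj : ‖j‖ = 1) (hz : ‖z‖ ≤ 1) :
    ‖bumpAt M j z‖ ≤ 3 * Real.exp (-(M * ‖z - j‖ ^ 2 / 2)) := by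
  have hre : (M * (z * starRingEnd ℂ j - 1)).re ≤ -(M * ‖z - j‖ ^ 2 / 2) := by
    rw [Complex.re_ofReal_mul, Complex.sq_norm, Complex.normSq_sub, ← Complex.sq_norm,
      ← Complex.sq_norm, hj, Complex.sub_re, Complex.one_re]
    have hz2 : ‖z‖ ^ 2 ≤ 1 := pow_le_one₀ (norm_nonneg z) hz
    nlinarith
  refine (norm_bump_le (hre.trans (by simp only [neg_nonpos]; positivity))).trans ?_
  gcongr

theorem exists_pos_separation (F : Finset ℂ) :
    ∃ s > 0, ∀ x ∈ F, ∀ y ∈ F, x ≠ y → s ≤ dist x y := by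
  obtain ⟨C, hC0, hC⟩ := einfsep_pos.1 F.finite_toSet.einfsep_pos
  refine ⟨(min C 1).toReal, ENNReal.toReal_pos (lt_min hC0 one_pos).ne' (by simp), ?_⟩
  intro x hx y hy hxy
  rw [dist_edist]
  exact ENNReal.toReal_mono (edist_ne_top _ _) ((min_le_left _ _).trans (hC x hx y hy hxy))

/-- A function of the disc algebra has arbitrarily small perturbations whose boundary values are,
off small discs around finitely many points, also attained in the open disc. The number of the
discs depends only on the size of the perturbation, not on the size of the discs. -/
theorem exists_perturbation {P : ℂ → ℂ} (hP : DiffContOnCl ℂ P (ball 0 1)) {ε : ℝ}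
    (hε : 0 < ε) :
    ∃ F : Finset ℂ, ∀ δ > 0, ∃ H : ℂ → ℂ, Differentiable ℂ H ∧
      (∀ z, ‖z‖ ≤ 1 → ‖H z‖ ≤ ε) ∧
      (∃ x ∈ ball (0 : ℂ) 1, ∃ y ∈ ball (0 : ℂ) 1, P x + H x ≠ P y + H y) ∧
      ∀ ζ : ℂ, ‖ζ‖ = 1 → ζ ∉ ⋃ j ∈ F, ball j δ →
        ∃ z ∈ ball (0 : ℂ) 1, P z + H z = P ζ + H ζ := by
  classical
  obtain ⟨c, hc0, hc⟩ := exists_le_norm_bump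
  -- One bump has size at most `3a` and the others together at most `τ ≤ a`, so `|H| ≤ 4a ≤ ε`.
  set a := ε / 6 with ha
  have ha0 : 0 < a := by positivity
  -- `τ` bounds all errors: the oscillation of `P` near net points and the tails of the bumps. The
  -- bump's variation `a * c` is at least `16τ`.
  set τ := min (a * c / 16) a
  have hτ0 : 0 < τ := by positivity
  have hτc : 16 * τ ≤ a * c := by linarith [min_le_left (a * c / 16) a]
  have hτa : τ ≤ a := min_le_right _ _
  have hPc : ContinuousOn P (closedBall 0 1) := closure_ball (0 : ℂ) one_ne_zero ▸ hP.continuousOn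
  obtain ⟨ρ, hρ0, hρ⟩ := Metric.uniformContinuousOn_iff_le.1
    ((isCompact_closedBall (0 : ℂ) 1).uniformContinuousOn_of_continuous hPc) τ hτ0
  obtain ⟨t, htT, htfin, htcov⟩ := (isCompact_sphere (0 : ℂ) 1).finite_cover_balls hρ0
  lift t to Finset ℂ using htfin
  refine ⟨t, fun δ hδ0 => ?_⟩
  obtain ⟨s, hs0, hs⟩ := exists_pos_separation t
  -- A point within `σ ≤ s / 2` of one net point is at distance at least `σ` from all others.
  set σ := min δ (s / 2)
  have hσ0 : 0 < σ := by positivity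
  have hσδ : σ ≤ δ := min_le_left _ _
  have hσs : 2 * σ ≤ s := by linarith [min_le_right δ (s / 2)]
  have hj1 : ∀ j ∈ t, ‖j‖ = 1 := fun j hj => mem_sphere_zero_iff_norm.1 (htT hj)
  -- The points `j(1 + L/M)` used below lie within `2/M` of `j`: close enough for `P` to vary by at
  -- most `τ`, and for the other bumps to be negligible.
  obtain ⟨M, hM20, hMρ, hMσ, hMexp⟩ : ∃ M : ℝ, 20 ≤ M ∧ 2 / M ≤ ρ ∧ 2 / M < σ ∧
      a * (t.card * (3 * Real.exp (-(M * σ ^ 2 / 2)))) ≤ τ := by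
    have h1 : Tendsto (fun M : ℝ => 2 / M) atTop (𝓝 0) := tendsto_const_nhds.div_atTop tendsto_id
    have h2 : Tendsto (fun M : ℝ => a * (t.card * (3 * Real.exp (-(M * σ ^ 2 / 2))))) atTop
        (𝓝 (a * (t.card * (3 * 0)))) := by
      refine (((Real.tendsto_exp_neg_atTop_nhds_zero.comp ?_).const_mul 3).const_mul _).const_mul _
      exact (tendsto_id.atTop_mul_const (by positivity : 0 < σ ^ 2)).atTop_div_const two_pos
    have h3 := (eventually_ge_atTop (20 : ℝ)).and <| (h1.eventually_lt_const hρ0).and <|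
      (h1.eventually_lt_const hσ0).and (h2.eventually_lt_const (by simpa using hτ0))
    obtain ⟨M, h4, h5, h6, h7⟩ := h3.exists
    exact ⟨M, h4, h5.le, h6, h7.le⟩
  have hM0 : 0 < M := by linarith
  let H : ℂ → ℂ := fun z => a * ∑ j ∈ t, bumpAt M j z
  have hHd : Differentiable ℂ H := by
    have := fun j => differentiable_bumpAt M j
    fun_prop
  have hfar : ∀ (u : Finset ℂ), u ⊆ t → ∀ z, ‖z‖ ≤ 1 → (∀ i ∈ u, σ ≤ dist z i) →
      ‖(a : ℂ) * ∑ j ∈ u, bumpAt M j z‖ ≤ τ := by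
    intro u hu z hz hzu
    have h1 : ‖∑ j ∈ u, bumpAt M j z‖ ≤ u.card * (3 * Real.exp (-(M * σ ^ 2 / 2))) := by
      rw [← nsmul_eq_mul, ← Finset.sum_const]
      refine norm_sum_le_of_le _ fun i hi => ?_
      refine (norm_bumpAt_le hM0.le (hj1 i (hu hi)) hz).trans ?_
      have := hzu i hi
      rw [dist_eq_norm] at this
      gcongr
    rw [norm_mul, Complex.norm_real, Real.norm_of_nonneg ha0.le]
    refine le_trans ?_ hMexp
    have hcard : (u.card : ℝ) ≤ t.card := by exact_mod_cast Finset.card_le_card hu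
    refine mul_le_mul_of_nonneg_left (h1.trans ?_) ha0.le
    gcongr
  have hnear : ∀ j ∈ t, ∀ z, ‖z‖ ≤ 1 → dist z j < σ → ‖H z - a * bumpAt M j z‖ ≤ τ := by
    intro j hj z hz hzj
    have : H z - a * bumpAt M j z = a * ∑ i ∈ t.erase j, bumpAt M i z := by
      simp only [H]
      rw [← Finset.add_sum_erase t _ hj]; ring
    rw [this]
    refine hfar _ (Finset.erase_subset _ _) z hz fun i hi => ?_
    have h1 := hs j hj i (Finset.mem_of_mem_erase hi) (Finset.ne_of_mem_erase hi).symm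
    have h2 := dist_triangle_left j i z
    linarith
  have hHfar : ∀ z, ‖z‖ ≤ 1 → (∀ i ∈ t, σ ≤ dist z i) → ‖H z‖ ≤ τ := hfar t subset_rfl
  have hHle : ∀ z, ‖z‖ ≤ 1 → ‖H z‖ ≤ ε := by
    intro z hz
    by_cases h : ∀ i ∈ t, σ ≤ dist z i
    · linarith [hHfar z hz h]
    · push Not at h
      obtain ⟨j, hj, hzj⟩ := h
      have h1 := hnear j hj z hz hzj
      have h2 : ‖(a : ℂ) * bumpAt M j z‖ ≤ a * 3 := by
        rw [norm_mul, Complex.norm_real, Real.norm_of_nonneg ha0.le]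
        refine mul_le_mul_of_nonneg_left ((norm_bumpAt_le hM0.le (hj1 j hj) hz).trans ?_) ha0.le
        have : Real.exp (-(M * ‖z - j‖ ^ 2 / 2)) ≤ 1 :=
          Real.exp_le_one_iff.2 (by simp only [neg_nonpos]; positivity)
        linarith
      have h3 := norm_le_norm_add_norm_sub ((a : ℂ) * bumpAt M j z) (H z)
      rw [norm_sub_rev] at h3
      linarith
  have hlocal : ∀ j ∈ t, ∀ L ∈ closedBall bumpZero (1 / 2),
      ‖P (j * (1 + L / M)) + H (j * (1 + L / M)) - (P j + a * bump L)‖ ≤ 2 * τ := by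
    intro j hj L hL
    have hz := norm_mul_one_add_div_lt_one (hj1 j hj) hM20 hL
    set z := j * (1 + L / M) with hzdef
    have hdist : dist z j ≤ 2 / M := by
      have : z - j = j * (L / M) := by rw [hzdef]; ring
      rw [dist_eq_norm, this, norm_mul, hj1 j hj, one_mul, norm_div, Complex.norm_real,
        Real.norm_of_nonneg hM0.le]
      gcongr
      exact norm_le_two_of_mem hL
    have h1 := hρ z (by simpa using hz.le) j (by simpa using (hj1 j hj).le) (hdist.trans hMρ)
    have h2 := hnear j hj z hz.le (hdist.trans_lt hMσ)
    rw [hzdef, bumpAt_mul_one_add_div (hj1 j hj) hM0.ne', ← hzdef] at h2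
    rw [dist_eq_norm] at h1
    have : P z + H z - (P j + a * bump L) = (P z - P j) + (H z - a * bump L) := by ring
    rw [this]
    exact (norm_add_le _ _).trans (by linarith)
  have h0mem : bumpZero ∈ closedBall bumpZero (1 / 2) := mem_closedBall_self (by norm_num)
  have hcen : ∀ j ∈ t, ‖P (j * (1 + bumpZero / M)) + H (j * (1 + bumpZero / M)) - P j‖ ≤
      2 * τ := by
    intro j hj
    simpa [bump_bumpZero] using hlocal j hj bumpZero h0mem
  -- Each of the two values is known up to `2τ`, leaving `16τ - 4τ = 12τ`.
  have hsph : ∀ j ∈ t, ∀ L ∈ sphere bumpZero (1 / 2), 12 * τ ≤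
      ‖P (j * (1 + L / M)) + H (j * (1 + L / M)) -
        (P (j * (1 + bumpZero / M)) + H (j * (1 + bumpZero / M)))‖ := by
    intro j hj L hL
    have h1 := hlocal j hj L (sphere_subset_closedBall hL)
    have h2 := hcen j hj
    have h3 : a * c ≤ ‖(a : ℂ) * bump L‖ := by
      rw [norm_mul, Complex.norm_real, Real.norm_of_nonneg ha0.le]
      exact mul_le_mul_of_nonneg_left (hc L hL) ha0.le
    set A := P (j * (1 + L / M)) + H (j * (1 + L / M))
    set B := P (j * (1 + bumpZero / M)) + H (j * (1 + bumpZero / M))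
    have h4 : (a : ℂ) * bump L = (A - B) - (A - (P j + a * bump L)) + (B - P j) := by ring
    have h5 := norm_add_le ((A - B) - (A - (P j + a * bump L))) (B - P j)
    have h6 := norm_sub_le (A - B) (A - (P j + a * bump L))
    rw [← h4] at h5
    linarith
  refine ⟨H, hHd, hHle, ?_, fun ζ hζ hζt => ?_⟩
  · obtain ⟨j, hj, -⟩ : ∃ j ∈ t, (1 : ℂ) ∈ ball j ρ := by
      simpa using htcov (show (1 : ℂ) ∈ sphere (0 : ℂ) 1 by simp)
    obtain ⟨L, hL⟩ := (NormedSpace.sphere_nonempty (x := bumpZero) (r := 1 / 2)).2 (by norm_num)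
    refine ⟨_, mem_ball_zero_iff.2 (norm_mul_one_add_div_lt_one (hj1 j hj) hM20
      (sphere_subset_closedBall hL)), _, mem_ball_zero_iff.2
      (norm_mul_one_add_div_lt_one (hj1 j hj) hM20 h0mem), fun heq => ?_⟩
    have := hsph j hj L hL
    rw [heq, sub_self, norm_zero] at this
    linarith
  · obtain ⟨j, hj, hζj⟩ : ∃ j ∈ t, ζ ∈ ball j ρ := by
      simpa using htcov (mem_sphere_zero_iff_norm.2 hζ)
    have hmaps : MapsTo (fun L : ℂ => j * (1 + L / M)) (ball bumpZero (1 / 2)) (ball 0 1) :=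
      fun L hL => mem_ball_zero_iff.2
        (norm_mul_one_add_div_lt_one (hj1 j hj) hM20 (ball_subset_closedBall hL))
    have hφ : DiffContOnCl ℂ (fun L : ℂ => P (j * (1 + L / M)) + H (j * (1 + L / M)))
        (ball bumpZero (1 / 2)) :=
      (hP.add hHd.diffContOnCl).comp (Differentiable.diffContOnCl (by fun_prop)) hmaps
    have hsub := ball_subset_image_of_sphere hφ (by norm_num) (by positivity) (hsph j hj)
    -- The covered disc has radius `6τ`, while the distance is at most `τ + τ + 2τ`.
    have hmem : P ζ + H ζ ∈ ball (P (j * (1 + bumpZero / M)) + H (j * (1 + bumpZero / M)))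
        (12 * τ / 2) := by
      have h1 := hρ ζ (by simp [hζ]) j (by simp [hj1 j hj]) hζj.le
      have h2 : ‖H ζ‖ ≤ τ := hHfar ζ hζ.le fun i hi => by
        by_contra! hlt
        exact hζt (mem_biUnion hi (mem_ball.2 (hlt.trans_le hσδ)))
      have h3 := hcen j hj
      rw [dist_eq_norm] at h1
      rw [mem_ball_iff_norm]
      set B := P (j * (1 + bumpZero / M)) + H (j * (1 + bumpZero / M))
      have h4 : P ζ + H ζ - B = (P ζ - P j) + H ζ - (B - P j) := by ring
      rw [h4]
      have h5 := norm_sub_le ((P ζ - P j) + H ζ) (B - P j)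
      have h6 := norm_add_le (P ζ - P j) (H ζ)
      linarith
    obtain ⟨L, hL, hLeq⟩ := hsub hmem
    exact ⟨_, mem_ball_zero_iff.2 (norm_mul_one_add_div_lt_one (hj1 j hj) hM20 hL), hLeq⟩

end ExtDisc

/-! ### Stability of attained boundary values, and the Baire argument -/

namespace ExtDisc

open Metric Set Filter Topology

/-- The pairs `(f, ζ)` with `f` of finite type, not constant, and `f(ζ) ∈ f(D)`. -/
def overlapSet : Set (ABar × ClosedDisc) :=
  {p | IsFiniteType p.1.1 ∧ (∃ x ∈ openDisc, p.1.1 x ≠ p.1.1 center) ∧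
    ∃ z ∈ openDisc, p.1.1 z = p.1.1 p.2}

theorem continuous_eval_aBar : Continuous fun p : ABar × ClosedDisc => p.1.1 p.2 := by
  fun_prop

theorem exists_sphere_ne {g : ℂ → ℂ} (hg : DifferentiableOn ℂ g (ball 0 1)) {x z₀ : ℂ}
    (hx : x ∈ ball (0 : ℂ) 1) (hz₀ : z₀ ∈ ball (0 : ℂ) 1) (hne : g x ≠ g z₀) :
    ∃ r > 0, closedBall z₀ r ⊆ ball 0 1 ∧ ∀ z ∈ sphere z₀ r, g z ≠ g z₀ := by
  have han := hg.analyticOnNhd isOpen_ball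
  rcases (han z₀ hz₀).eventually_eq_or_eventually_ne (analyticAt_const (v := g z₀)) with h | h
  · exact absurd (han.eqOn_of_preconnected_of_eventuallyEq analyticOnNhd_const
      (convex_ball 0 1).isPreconnected hz₀ h hx) hne
  · rw [eventually_nhdsWithin_iff] at h
    obtain ⟨s, hs0, hs⟩ := Metric.eventually_nhds_iff_ball.1
      (h.and (isOpen_ball.eventually_mem hz₀))
    refine ⟨s / 2, half_pos hs0, fun z hz => (hs z ?_).2, fun z hz => (hs z ?_).1 ?_⟩
    · exact closedBall_subset_ball (half_lt_self hs0) hz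
    · exact closedBall_subset_ball (half_lt_self hs0) (sphere_subset_closedBall hz)
    · exact ne_of_mem_sphere hz (half_pos hs0).ne'

/-- On a small circle about `z₀`, `f` stays at distance `c > 0` from `f(z₀) = f(ζ)`. For nearby
`(f', ζ')`, `f'` stays `c/2` away from `f'(z₀)` on it, and `f'(ζ')` is within `c/4` of `f'(z₀)`,
hence attained inside. Nonconstancy is essential: `w + εz` does not attain its value at `1` inside
`D`, however small `ε > 0`. -/
theorem isOpen_overlapSet : IsOpen overlapSet := by
  rw [isOpen_iff_mem_nhds]
  rintro ⟨f, ζ⟩ ⟨hfin, ⟨x, hx, hxne⟩, z₀, hz₀, hz₀ζ⟩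
  have hball : ∀ {z : ClosedDisc}, z ∈ openDisc → (z : ℂ) ∈ ball (0 : ℂ) 1 := fun hz =>
    mem_ball_zero_iff.2 hz
  obtain ⟨g, hg, hfg⟩ := id hfin
  obtain ⟨y, hy, hyne⟩ : ∃ y ∈ ball (0 : ℂ) 1, g y ≠ g z₀ := by
    by_contra! hcon
    refine hxne ?_
    rw [hfg x hx, hfg _ center_mem_openDisc, hcon _ (hball hx),
      hcon _ (hball center_mem_openDisc)]
  obtain ⟨r, hr0, hrD, hrne⟩ := exists_sphere_ne hg hy (hball hz₀) hyne
  obtain ⟨w, hw, hmin⟩ := (isCompact_sphere (z₀ : ℂ) r).exists_isMinOn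
    (NormedSpace.sphere_nonempty.2 hr0.le) (f := fun z => ‖g z - g z₀‖)
    (((hg.continuousOn.mono (sphere_subset_closedBall.trans hrD)).sub continuousOn_const).norm)
  set c := ‖g w - g z₀‖
  have hc0 : 0 < c := norm_pos_iff.2 (sub_ne_zero.2 (hrne w hw))
  let E : ABar × ClosedDisc → ℂ := fun p => CBar.val (p.1.1 p.2)
  have hE : ∀ z ∈ openDisc, E (f, z) = g z := fun z hz => by simp [E, hfg z hz]
  have hEc : ∀ z, f.1 z ∈ range CBar.fin → ContinuousAt E (f, z) := by
    rintro z ⟨v, hv⟩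
    have := CBar.continuousAt_val v
    rw [hv] at this
    exact ContinuousAt.comp (x := (f, z)) (f := fun p : ABar × ClosedDisc => p.1.1 p.2) this
      continuous_eval_aBar.continuousAt
  have hEz₀ : ContinuousAt E (f, z₀) := hEc _ ⟨_, (hfg z₀ hz₀).symm⟩
  have hζfin : f.1 ζ ∈ range CBar.fin := ⟨g z₀, by rw [← hfg z₀ hz₀]; exact hz₀ζ⟩
  have hK : IsCompact {z : ClosedDisc | (z : ℂ) ∈ sphere (z₀ : ℂ) r} :=
    (isClosed_sphere.preimage continuous_subtype_val).isCompact
  have ev1 : ∀ᶠ p : ABar × ClosedDisc in 𝓝 (f, ζ),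
      ∀ z ∈ {z : ClosedDisc | (z : ℂ) ∈ sphere (z₀ : ℂ) r},
        c / 2 < ‖E (p.1, z) - E (p.1, z₀)‖ := by
    refine hK.eventually_forall_of_forall_eventually fun z hz => ?_
    have hzD : z ∈ openDisc := mem_ball_zero_iff.1 (hrD (sphere_subset_closedBall hz))
    have h1 : ContinuousAt (fun q : (ABar × ClosedDisc) × ClosedDisc => E (q.1.1, q.2))
        ((f, ζ), z) :=
      ContinuousAt.comp (x := ((f, ζ), z)) (g := E)
        (f := fun q : (ABar × ClosedDisc) × ClosedDisc => (q.1.1, q.2))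
        (hEc z ⟨_, (hfg z hzD).symm⟩) (by fun_prop)
    have h2 : ContinuousAt (fun q : (ABar × ClosedDisc) × ClosedDisc => E (q.1.1, z₀))
        ((f, ζ), z) :=
      ContinuousAt.comp (x := ((f, ζ), z)) (g := E)
        (f := fun q : (ABar × ClosedDisc) × ClosedDisc => (q.1.1, z₀))
        hEz₀ (by fun_prop)
    refine (h1.sub h2).norm.eventually_const_lt ?_
    change c / 2 < ‖E (f, z) - E (f, z₀)‖
    rw [hE z hzD, hE z₀ hz₀]
    exact (half_lt_self hc0).trans_le (hmin hz)
  have ev2 : ∀ᶠ p : ABar × ClosedDisc in 𝓝 (f, ζ), ‖E p - E (p.1, z₀)‖ < c / 2 / 2 := by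
    have h2 : ContinuousAt (fun p : ABar × ClosedDisc => E (p.1, z₀)) (f, ζ) :=
      ContinuousAt.comp (x := (f, ζ)) (g := E)
        (f := fun p : ABar × ClosedDisc => (p.1, z₀)) hEz₀ (by fun_prop)
    refine ((hEc ζ hζfin).sub h2).norm.eventually_lt_const ?_
    have : E (f, ζ) = E (f, z₀) := congrArg CBar.val hz₀ζ.symm
    change ‖E (f, ζ) - E (f, z₀)‖ < c / 2 / 2
    rw [this, sub_self, norm_zero]
    positivity
  -- Finiteness at `ζ'` must be imposed separately, since `val` is `0` at infinite points.
  have ev3 : ∀ᶠ p : ABar × ClosedDisc in 𝓝 (f, ζ), p.1.1 p.2 ∈ range CBar.fin :=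
    continuous_eval_aBar.continuousAt.eventually_mem (CBar.isOpen_range_fin.mem_nhds hζfin)
  have ev4 : ∀ᶠ p : ABar × ClosedDisc in 𝓝 (f, ζ), IsFiniteType p.1.1 :=
    continuous_fst.continuousAt.eventually_mem (isOpen_isFiniteType.mem_nhds hfin)
  have ev5 : ∀ᶠ p : ABar × ClosedDisc in 𝓝 (f, ζ), p.1.1 x ≠ p.1.1 center := by
    have h : IsOpen {p : ABar × ClosedDisc | p.1.1 x ≠ p.1.1 center} :=
      isOpen_ne_fun (by fun_prop) (by fun_prop)
    exact h.mem_nhds hxne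
  filter_upwards [ev1, ev2, ev3, ev4, ev5]
  rintro ⟨f', ζ'⟩ h1 h2 ⟨v, hv⟩ h4 h5
  refine ⟨h4, ⟨x, hx, h5⟩, ?_⟩
  obtain ⟨g', hg', hfg'⟩ := h4
  have hE' : ∀ z ∈ openDisc, E (f', z) = g' z := fun z hz => by simp [E, hfg' z hz]
  have hEv : E (f', ζ') = v := by
    change CBar.val (f'.1 ζ') = v
    rw [← hv, CBar.val_fin]
  have hsub := ball_subset_image_of_sphere
    ((hg'.mono hrD).diffContOnCl_ball subset_rfl) hr0 (half_pos hc0) fun z hz => by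
      have hzD := hrD (sphere_subset_closedBall hz)
      have := h1 ⟨z, ball_subset_closedBall hzD⟩ hz
      rw [hE' _ (mem_ball_zero_iff.1 hzD), hE' _ hz₀] at this
      exact this.le
  have hmem : v ∈ ball (g' z₀) (c / 2 / 2) := by
    rw [hEv, hE' _ hz₀] at h2
    exact mem_ball_iff_norm.2 h2
  obtain ⟨z, hz, hzv⟩ := hsub hmem
  have hzD := hrD hz
  refine ⟨⟨z, ball_subset_closedBall hzD⟩, mem_ball_zero_iff.1 hzD, ?_⟩
  rw [hfg' _ (mem_ball_zero_iff.1 hzD), hzv]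
  exact hv

/-- The functions of finite type whose exceptional set is contained in an open set of content at
most `1 / n`, in a sense stable under perturbation. -/
def smallExceptionalSet (η : ℝ≥0 → ℝ≥0) (n : ℕ) : Set ABar :=
  {f | IsFiniteType f.1 ∧ ∃ U : Set ℂ, IsOpen U ∧
    hausdorffContent η (n : ℝ≥0∞)⁻¹ U ≤ (n : ℝ≥0∞)⁻¹ ∧
    ∀ ζ ∈ unitCircle, (ζ : ℂ) ∉ U → (f, ζ) ∈ overlapSet}

/-- The same `U` serves all nearby functions, by the tube lemma over the compact set `T \ U`. -/
theorem isOpen_smallExceptionalSet (η : ℝ≥0 → ℝ≥0) (n : ℕ) :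
    IsOpen (smallExceptionalSet η n) := by
  rw [isOpen_iff_mem_nhds]
  rintro f ⟨hf, U, hU, hUc, hfU⟩
  have hT : IsClosed unitCircle :=
    isClosed_eq (continuous_norm.comp continuous_subtype_val) continuous_const
  have hK : IsCompact {ζ : ClosedDisc | ζ ∈ unitCircle ∧ (ζ : ℂ) ∉ U} :=
    (hT.inter (hU.isClosed_compl.preimage continuous_subtype_val)).isCompact
  have h : ∀ᶠ f' in 𝓝 f, ∀ ζ ∈ {ζ : ClosedDisc | ζ ∈ unitCircle ∧ (ζ : ℂ) ∉ U},
      (f', ζ) ∈ overlapSet :=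
    hK.eventually_forall_of_forall_eventually fun ζ hζ =>
      isOpen_overlapSet.mem_nhds (hfU ζ hζ.1 hζ.2)
  filter_upwards [h, isOpen_isFiniteType.mem_nhds hf] with f' h1 h2
  exact ⟨h2, U, hU, hUc, fun ζ hζ hζU => h1 ζ ⟨hζ, hζU⟩⟩

theorem DiscAlgebra.exists_extension (p : DiscAlgebra) :
    ∃ P : ℂ → ℂ, DiffContOnCl ℂ P (ball 0 1) ∧ ∀ z : ClosedDisc, p.1 z = P z := by
  classical
  obtain ⟨g, hg, hpg⟩ := p.2
  let P : ℂ → ℂ := fun z => if h : z ∈ closedBall (0 : ℂ) 1 then p.1 ⟨z, h⟩ else 0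
  have hP : ∀ z : ClosedDisc, p.1 z = P z := fun z =>
    Eq.symm (show P z = p.1 z from dif_pos z.2)
  refine ⟨P, ⟨hg.congr fun z hz => ?_, ?_⟩, hP⟩
  · rw [← hP ⟨z, ball_subset_closedBall hz⟩, hpg _ (mem_ball_zero_iff.1 hz)]
  · rw [closure_ball (0 : ℂ) one_ne_zero, continuousOn_iff_continuous_domRestrict]
    exact p.1.continuous.congr hP

theorem dense_preimage_smallExceptionalSet {η : ℝ≥0 → ℝ≥0} (hη : IsHausdorffMeasureFunction η)
    (n : ℕ) : Dense (DiscAlgebra.toABar ⁻¹' smallExceptionalSet η n) := by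
  refine Metric.dense_iff.2 fun p ε hε => ?_
  obtain ⟨P, hP, hpP⟩ := p.exists_extension
  obtain ⟨F, hF⟩ := exists_perturbation hP (half_pos hε)
  obtain ⟨δ, hδ0, hδ⟩ := hη.exists_balls_content_le F (r := (n : ℝ≥0∞)⁻¹) (by simp)
  obtain ⟨H, hHd, hHle, ⟨x, hx, y, hy, hxy⟩, hH⟩ := hF δ hδ0
  let q : DiscAlgebra := ⟨⟨fun z => p.1 z + H z, by
      have := hHd.continuous
      fun_prop⟩, fun z => P z + H z, hP.differentiableOn.add hHd.differentiableOn,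
      fun z _ => by simp [hpP]⟩
  have hq : ∀ z : ClosedDisc, q.toABar.1 z = CBar.fin (P z + H z) := fun z => by
    rw [← hpP]; rfl
  have hqfin : IsFiniteType q.toABar.1 :=
    (isFiniteType_iff _).2 ⟨_, rfl⟩
  have hne : ∃ w ∈ openDisc, q.toABar.1 w ≠ q.toABar.1 center := by
    by_contra! hcon
    have h1 := hcon ⟨x, ball_subset_closedBall hx⟩ (mem_ball_zero_iff.1 hx)
    have h2 := hcon ⟨y, ball_subset_closedBall hy⟩ (mem_ball_zero_iff.1 hy)
    have h3 := h1.trans h2.symm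
    rw [hq, hq] at h3
    exact hxy (CBar.fin.inj h3)
  refine ⟨q, ?_, hqfin, _, isOpen_biUnion fun _ _ => isOpen_ball, hδ, fun ζ hζ hζU => ?_⟩
  · refine lt_of_le_of_lt ((ContinuousMap.dist_le (half_pos hε).le).2 fun z => ?_)
      (half_lt_self hε)
    have : dist (q.1 z) (p.1 z) = ‖H z‖ := by
      rw [dist_eq_norm]
      congr 1
      exact add_sub_cancel_left _ _
    rw [this]
    exact hHle z (mem_closedBall_zero_iff.1 z.2)
  · obtain ⟨z, hz, hzζ⟩ := hH ζ hζ hζU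
    refine ⟨hqfin, hne, ⟨z, ball_subset_closedBall hz⟩, mem_ball_zero_iff.1 hz, ?_⟩
    simp only [hq, hzζ]

theorem hausdorffMeasureOf_exceptionalSet_eq_zero {η : ℝ≥0 → ℝ≥0} {f : ABar}
    (hf : ∀ n, f ∈ smallExceptionalSet η n) :
    hausdorffMeasureOf η (exceptionalSet f.1) = 0 := by
  refine hausdorffMeasureOf_eq_zero_of_content η fun n => ?_
  obtain ⟨-, U, -, hUc, hU⟩ := hf n
  refine ⟨U, ?_, hUc⟩
  rintro _ ⟨ζ, ⟨hζ, hζf⟩, rfl⟩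
  by_contra hζU
  obtain ⟨-, -, z, hz, hzζ⟩ := hU ζ hζ hζU
  exact hζf ⟨z, hz, hzζ⟩

/-- The functions of finite type that are constant on the open disc. -/
def finiteConstants : Set ABar :=
  {f | IsFiniteType f.1 ∧ ∀ z ∈ openDisc, f.1 z = f.1 center}

theorem isGδ_finiteConstants : IsGδ finiteConstants := by
  have h : finiteConstants = {f : ABar | IsFiniteType f.1} ∩
      ⋂ z ∈ openDisc, {f : ABar | f.1 z = f.1 center} := by
    ext
    simp [finiteConstants]
  rw [h]
  exact isOpen_isFiniteType.isGδ.inter (isClosed_biInter fun z _ =>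
    isClosed_eq (by fun_prop) (by fun_prop)).isGδ

/-- By continuity along radii, the boundary values equal the value at the centre. -/
theorem exceptionalSet_eq_empty_of_constant {f : C(ClosedDisc, CBar)}
    (hf : ∀ z ∈ openDisc, f z = f center) : exceptionalSet f = ∅ := by
  refine image_eq_empty.2 (eq_empty_of_forall_notMem fun ζ hζ => hζ.2 ?_)
  refine ⟨center, center_mem_openDisc, dist_le_zero.1 (le_of_forall_pos_le_add fun ε hε => ?_)⟩
  obtain ⟨r, hr1, hr⟩ := exists_scale_close f hε
  have := hr ζ
  rw [hf _ (scale_mem_openDisc hr1 ζ)] at this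
  linarith

theorem setOf_exceptionalSet_null {η : ℝ≥0 → ℝ≥0} (hη : IsHausdorffMeasureFunction η) :
    {f : ABar | IsFiniteType f.1 ∧ hausdorffMeasureOf η (exceptionalSet f.1) = 0} =
      (⋂ n, smallExceptionalSet η n) ∪ finiteConstants := by
  ext f
  constructor
  · rintro ⟨hfin, h0⟩
    by_cases hconst : ∀ z ∈ openDisc, f.1 z = f.1 center
    · exact Or.inr ⟨hfin, hconst⟩
    push Not at hconst
    refine Or.inl (mem_iInter.2 fun n => ⟨hfin, ?_⟩)
    obtain ⟨U, hU, hEU, hUc⟩ := hη.exists_isOpen_content_le h0 (r := (n : ℝ≥0∞)⁻¹) (by simp)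
    refine ⟨U, hU, hUc, fun ζ hζ hζU => ⟨hfin, hconst, ?_⟩⟩
    by_contra hcon
    exact hζU (hEU ⟨ζ, ⟨hζ, hcon⟩, rfl⟩)
  · rintro (h | ⟨hfin, hconst⟩)
    · rw [mem_iInter] at h
      -- Since `0⁻¹ = ⊤`, the condition for `n = 0` only says that `f` is of finite type.
      exact ⟨(h 0).1, hausdorffMeasureOf_exceptionalSet_eq_zero h⟩
    · exact ⟨hfin, by rw [exceptionalSet_eq_empty_of_constant hconst]; simp⟩

end ExtDisc

theorem proposition5p3 (η : NNReal → NNReal) (hη : ExtDisc.IsHausdorffMeasureFunction η) :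
    Dense {f : ExtDisc.ABar | ExtDisc.IsFiniteType f.1 ∧
      ExtDisc.hausdorffMeasureOf η (ExtDisc.exceptionalSet f.1) = 0} ∧
    IsGδ {f : ExtDisc.ABar | ExtDisc.IsFiniteType f.1 ∧
      ExtDisc.hausdorffMeasureOf η (ExtDisc.exceptionalSet f.1) = 0} := by
  open ExtDisc in
  rw [setOf_exceptionalSet_null hη]
  refine ⟨?_, (IsGδ.iInter fun n => (isOpen_smallExceptionalSet η n).isGδ).union
    isGδ_finiteConstants⟩
  -- Baire is used in the disc algebra, and density is then pushed forward, so completeness of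
  -- `ABar` is not needed.
  have hdense : Dense (⋂ n, DiscAlgebra.toABar ⁻¹' smallExceptionalSet η n) :=
    dense_iInter_of_isOpen
      (fun n => (isOpen_smallExceptionalSet η n).preimage DiscAlgebra.continuous_toABar)
      (dense_preimage_smallExceptionalSet hη)
  refine DiscAlgebra.denseRange_toABar.dense_of_mapsTo DiscAlgebra.continuous_toABar hdense ?_
  intro p hp
  exact Or.inl (Set.mem_iInter.2 fun n => Set.mem_iInter.1 hp n)
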